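/- Let $k$ be a positive integer, let $A$ be a $k\times k$ integer matrix, and let $\mu$ be a probability distribution on $\mathbf Z^k$. Let $\mathbf B_0,\mathbf B_1,\dots$ be independent random vectors in $\mathbf Z^k$ with distribution $\mu$, let $\mathbf x_0\in\mathbf Z^k$, and for a positive integer $p$ let $(\mathbf X_n)_{n\ge 0}$ be the Markov chain on $\mathbf Z_p^k=(\mathbf Z/p\mathbf Z)^k$ given by $\mathbf X_0=\mathbf x_0$ and $\mathbf X_{n+1}=A\mathbf X_n+\mathbf B_n \pmod p$. Let $P_n(\mathbf x)=\Pr(\mathbf X_n=\mathbf x)$ for $\mathbf x\in\mathbf Z_p^k$, let $U$ be the uniform distribution on $\mathbf Z_p^k$, and let $\|P_n-U\|=\frac12\sum_{\mathbf x\in\mathbf Z_p^k}|P_n(\mathbf x)-U(\mathbf x)|$. Let $V=\{\mathbf h-\mathbf l:\mathbf h,\mathbf l\in\operatorname{supp}\mu\}$, let $d$ be the degree of the minimal polynomial of $A$, and let $V^{d-1}=\{A^m\mathbf x:\mathbf x\in V,\ m=0,1,\dots,d-1\}$. Theorem 3.1. Suppose that every complex eigenvalue $\lambda$ of $A$ satisfies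 $\lambda\ne0$ and $|\lambda|\neq 1$, and that $\operatorname{supp}\mu$ is not parallel to any proper $A$-invariant subspace $W$ of $\mathbf Q^k$, that is, $\operatorname{supp}\mu$ is not contained in any translate of such a $W$ (where $W=\{\mathbf 0\}$ counts as proper). Then $V^{d-1}$ contains a basis of $\mathbf Q^k$. Moreover, for every integer matrix $B$ whose columns are vectors of $V^{d-1}$ and form a basis of $\mathbf Q^k$, there are a constant $c>0$ and a function $\varepsilon$ with $\varepsilon(p)\to0$ as $p\to\infty$, both depending only on $A$, $\mu$ and $B$, such that for all positive integers $p$ with $\gcd(\det A,p)=\gcd(\det B,p)=1$ and all integers $n\ge c(\ln p)^2$, $$\|P_n-U\|\le\varepsilon(p).$$ -/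

import Mathlib

open MeasureTheory ProbabilityTheory Filter Topology

noncomputable section

namespace AffineChain

/-- An integer vector, viewed in `ℚ^k`. -/
def toRat {k : ℕ} (x : Fin k → ℤ) : Fin k → ℚ := fun i => (x i : ℚ)

/-- The reduction modulo `p` of an integer vector. -/
def toZMod (p : ℕ) {k : ℕ} (x : Fin k → ℤ) : Fin k → ZMod p := fun i => (x i : ZMod p)

/-- The subspace `W` of `ℚ^k` is invariant under the integer matrix `A`. -/
def IsInvariant {k : ℕ} (A : Matrix (Fin k) (Fin k) ℤ) (W : Submodule ℚ (Fin k → ℚ)) : Prop :=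
  ∀ w ∈ W, (A.map (Int.cast : ℤ → ℚ)).mulVec w ∈ W

/-- A set `S` of integer vectors is parallel to `W` if it lies in a translate `a + W`. -/
def IsParallelTo {k : ℕ} (S : Set (Fin k → ℤ)) (W : Submodule ℚ (Fin k → ℚ)) : Prop :=
  ∃ a : Fin k → ℚ, ∀ x ∈ S, toRat x - a ∈ W

/-- The set `V` of differences of elements of the support of `μ`. -/
def diffSet {k : ℕ} (μ : PMF (Fin k → ℤ)) : Set (Fin k → ℤ) :=
  {x | ∃ h ∈ μ.support, ∃ l ∈ μ.support, x = h - l}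

/-- The degree of the minimal polynomial of `A`. -/
def minDegree {k : ℕ} (A : Matrix (Fin k) (Fin k) ℤ) : ℕ :=
  (minpoly ℚ (A.map (Int.cast : ℤ → ℚ))).natDegree

/-- The set `{A ^ m x : x ∈ V, m = 0, …, d - 1}`, where `d` is the degree of the minimal
polynomial of `A`. -/
def orbitSet {k : ℕ} (A : Matrix (Fin k) (Fin k) ℤ) (μ : PMF (Fin k → ℤ)) :
    Set (Fin k → ℤ) :=
  {y | ∃ x ∈ diffSet μ, ∃ m < minDegree A, y = (A ^ m).mulVec x}

/-- The columns of `B` are elements of `orbitSet A μ` and form a basis of `ℚ^k`. -/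
def IsBasisMatrix {k : ℕ} (A : Matrix (Fin k) (Fin k) ℤ) (μ : PMF (Fin k → ℤ))
    (B : Matrix (Fin k) (Fin k) ℤ) : Prop :=
  (∀ j, (fun i => B i j) ∈ orbitSet A μ) ∧
    LinearIndependent ℚ (fun j => toRat (fun i => B i j)) ∧
    Submodule.span ℚ (Set.range (fun j => toRat (fun i => B i j))) = ⊤

/-- The chain `X₀ = x₀`, `Xₙ₊₁ = A Xₙ + bₙ (mod p)`. -/
def chain {Ω : Type*} (p : ℕ) {k : ℕ} (A : Matrix (Fin k) (Fin k) ℤ) (x₀ : Fin k → ℤ)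
    (b : ℕ → Ω → (Fin k → ℤ)) : ℕ → Ω → (Fin k → ZMod p)
  | 0 => fun _ => toZMod p x₀
  | n + 1 => fun ω =>
      (A.map (Int.cast : ℤ → ZMod p)).mulVec (chain p A x₀ b n ω) + toZMod p (b n ω)

/-- `b₀, b₁, …` are independent random vectors on `(Ω, P)`, each with distribution `μ`. -/
structure IsIIDWithLaw {Ω : Type*} [MeasurableSpace Ω] {k : ℕ} (P : Measure Ω)
    (b : ℕ → Ω → (Fin k → ℤ)) (μ : PMF (Fin k → ℤ)) : Prop where
  measurable : ∀ n, Measurable (b n)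
  indep : iIndepFun b P
  law : ∀ n x, P {ω | b n ω = x} = μ x

/-- The mass function `Pₙ(x) = P(Xₙ = x)` on `(ℤ/p)^k`. -/
def chainLaw {Ω : Type*} [MeasurableSpace Ω] (P : Measure Ω) (p : ℕ) {k : ℕ}
    (A : Matrix (Fin k) (Fin k) ℤ) (x₀ : Fin k → ℤ) (b : ℕ → Ω → (Fin k → ℤ)) (n : ℕ) :
    (Fin k → ZMod p) → ℝ :=
  fun x => P.real {ω | chain p A x₀ b n ω = x}

/-- The uniform mass function on a finite set. -/
def uniformMass (S : Type*) [Fintype S] : S → ℝ := fun _ => 1 / (Fintype.card S : ℝ)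

/-- The total variation distance of two mass functions on a finite set. -/
def tvDist {S : Type*} [Fintype S] (f g : S → ℝ) : ℝ := (1 / 2) * ∑ x, |f x - g x|

end AffineChain

end

/-! By the upper bound lemma (`tvDist_uniformMass_sq_le`) it is enough to bound the nonzero Fourier
coefficients of the law. Independence makes the coefficient at `α` a product, over `j < n`, of
values of the Fourier transform of `μ` at the dual iterates of `α` under the transpose of `A`
(`norm_fourierSum_chainLaw`). If every window of O(log p) factors contains one at most `1 - δ`, then
c (log p)² steps make each squared coefficient O(p^{-(k+1)}), which beats the number `p ^ k` of
frequencies.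

Such a factor exists because a factor close to 1 forces its frequency to be almost orthogonal mod
`p` to the differences behind the columns of `B` (`exists_gap`). If that held throughout a window,
multiplying the small residues against the columns by the adjugate of `Bᵀ` would give integer
vectors of size below `p / 2`. They follow `Aᵀ` modulo `p`, hence exactly, since both sides are
small, and they are nonzero since `det B` is a unit mod `p` (`exists_far_iterate`). A hyperbolic
matrix has no such orbit: in one time direction or the other it expands every vector exponentially
(`exists_exponential_expansion`), so within O(log p) steps some entry exceeds `p`
(`exists_large_entry`). -/

noncomputable section

namespace AffineChain

/-! ### Expansion by hyperbolic automorphisms -/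

section Hyperbolic

variable {E : Type*} [NormedAddCommGroup E] [NormedSpace ℂ E]

/-- The vectors whose two-sided orbit under `T` is bounded. -/
def boundedOrbits (T : E ≃ₗ[ℂ] E) : Submodule ℂ E where
  carrier := {z | ∃ C : ℝ, ∀ j : ℤ, ‖(T ^ j) z‖ ≤ C}
  zero_mem' := ⟨0, by simp⟩
  add_mem' := by
    rintro x y ⟨C, hC⟩ ⟨D, hD⟩
    refine ⟨C + D, fun j => ?_⟩
    rw [map_add]
    exact (norm_add_le _ _).trans (add_le_add (hC j) (hD j))
  smul_mem' := by
    rintro a x ⟨C, hC⟩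
    refine ⟨‖a‖ * C, fun j => ?_⟩
    rw [map_smul, norm_smul]
    exact mul_le_mul_of_nonneg_left (hC j) (norm_nonneg _)

lemma zpow_apply_add (T : E ≃ₗ[ℂ] E) (i j : ℤ) (z : E) : (T ^ (i + j)) z = (T ^ i) ((T ^ j) z) := by
  rw [zpow_add]; rfl

lemma zpow_apply_eigenvector (T : E ≃ₗ[ℂ] E) {a : ℂ} {z : E} (h : T z = a • z) (ha : a ≠ 0)
    (j : ℤ) : (T ^ j) z = a ^ j • z := by
  have key : ∀ j : ℤ, (T ^ (j + 1)) z = a • (T ^ j) z := fun j => by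
    rw [zpow_apply_add, zpow_one, h, map_smul]
  induction j with
  | zero => simp
  | succ i ih => rw [key, ih, smul_smul, zpow_add_one₀ ha, mul_comm]
  | pred i ih =>
    have h1 := key (-(i : ℤ) - 1)
    rw [sub_add_cancel, ih] at h1
    rw [zpow_sub_one₀ ha, mul_comm, ← smul_smul, h1, smul_smul, inv_mul_cancel₀ ha, one_smul]

lemma norm_eq_one_of_zpow_bounded {r C : ℝ} (hr : 0 < r) (h : ∀ j : ℤ, r ^ j ≤ C) : r = 1 := by
  by_contra hne
  rcases lt_or_gt_of_ne hne with h1 | h1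
  · obtain ⟨n, hn⟩ := pow_unbounded_of_one_lt C (one_lt_inv₀ hr |>.2 h1)
    have := h (-(n : ℤ))
    rw [zpow_neg, zpow_natCast, ← inv_pow] at this
    linarith
  · obtain ⟨n, hn⟩ := pow_unbounded_of_one_lt C h1
    have := h n
    rw [zpow_natCast] at this
    linarith

variable [FiniteDimensional ℂ E]

/-- The subspace is `T`-invariant, so if nonzero it contains an eigenvector; boundedness in both
time directions then puts the eigenvalue on the unit circle. -/
lemma boundedOrbits_eq_bot (T : E ≃ₗ[ℂ] E)
    (hT : ∀ a : ℂ, Module.End.HasEigenvalue (T : E →ₗ[ℂ] E) a → ‖a‖ ≠ 1) :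
    boundedOrbits T = ⊥ := by
  by_contra hne
  have : Nontrivial (boundedOrbits T) := Submodule.nontrivial_iff_ne_bot.2 hne
  have hinv : ∀ x ∈ boundedOrbits T, (T : E →ₗ[ℂ] E) x ∈ boundedOrbits T := by
    rintro x ⟨C, hC⟩
    refine ⟨C, fun j => ?_⟩
    have := hC (j + 1)
    rwa [zpow_apply_add, zpow_one] at this
  obtain ⟨a, ha⟩ := Module.End.exists_eigenvalue ((T : E →ₗ[ℂ] E).restrict hinv)
  obtain ⟨v, hv⟩ := ha.exists_hasEigenvector
  have hv0 : (v : E) ≠ 0 := fun h => hv.2 (Subtype.ext h)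
  have hTv : T (v : E) = a • (v : E) := congrArg Subtype.val hv.apply_eq_smul
  have ha0 : a ≠ 0 := by
    rintro rfl
    rw [zero_smul] at hTv
    exact hv0 (T.map_eq_zero_iff.1 hTv)
  refine hT a (Module.End.hasEigenvalue_of_hasEigenvector
    (x := (v : E)) ⟨Module.End.mem_eigenspace_iff.2 hTv, hv0⟩) ?_
  obtain ⟨C, hC⟩ := v.2
  refine norm_eq_one_of_zpow_bounded (C := C / ‖(v : E)‖) (norm_pos_iff.2 ha0) fun j => ?_
  rw [le_div_iff₀ (norm_pos_iff.2 hv0), ← norm_zpow, ← norm_smul,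
    ← zpow_apply_eigenvector T hTv ha0]
  exact hC j

lemma continuous_zpow_apply (T : E ≃ₗ[ℂ] E) (j : ℤ) : Continuous fun z => (T ^ j) z :=
  LinearMap.continuous_of_finiteDimensional ((T ^ j : E ≃ₗ[ℂ] E) : E →ₗ[ℂ] E)

/-- Uniform expansion, in one of the two time directions, of a hyperbolic automorphism. -/
lemma exists_expansion (T : E ≃ₗ[ℂ] E)
    (hT : ∀ a : ℂ, Module.End.HasEigenvalue (T : E →ₗ[ℂ] E) a → ‖a‖ ≠ 1) :
    ∃ m : ℕ, ∀ z : E, ∃ j : ℤ, |j| ≤ m ∧ 2 * ‖z‖ ≤ ‖(T ^ j) z‖ := by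
  by_contra! hcon
  have : ProperSpace E := FiniteDimensional.proper ℂ E
  -- Compactness: if no `m` works, these nested compact sets are nonempty, and a common point is a
  -- unit vector with bounded two-sided orbit.
  let K : ℕ → Set E := fun m =>
    Metric.sphere 0 1 ∩ ⋂ j : ℤ, ⋂ _ : |j| ≤ m, {z | ‖(T ^ j) z‖ ≤ 2}
  have hcl : ∀ m, IsClosed (K m) := fun m =>
    Metric.isClosed_sphere.inter <| isClosed_iInter fun j => isClosed_iInter fun _ =>
      isClosed_le (continuous_zpow_apply T j).norm continuous_const
  obtain ⟨z, hz⟩ := IsCompact.nonempty_iInter_of_sequence_nonempty_isCompact_isClosed K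
    (fun m z hz => ⟨hz.1, Set.mem_iInter₂.2 fun j hj => Set.mem_iInter₂.1 hz.2 j
      (hj.trans (by push_cast; linarith))⟩)
    (fun m => by
      obtain ⟨z, hz⟩ := hcon m
      have hz0 : 0 < ‖z‖ := by
        have := hz 0 (by simp)
        simp only [zpow_zero, LinearEquiv.coe_one, id_eq] at this
        linarith [norm_nonneg z]
      refine ⟨(‖z‖⁻¹ : ℂ) • z, ?_, Set.mem_iInter₂.2 fun j hj => ?_⟩
      · simp [norm_smul, hz0.ne']
      · change ‖(T ^ j) ((‖z‖⁻¹ : ℂ) • z)‖ ≤ 2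
        rw [map_smul, norm_smul, norm_inv, Complex.norm_real, norm_norm,
          inv_mul_le_iff₀ hz0, mul_comm]
        exact (hz j hj).le)
    ((isCompact_sphere _ _).of_isClosed_subset (hcl 0) Set.inter_subset_left) hcl
  have hz' := fun m => Set.mem_iInter.1 hz m
  have hmem : z ∈ boundedOrbits T := ⟨2, fun j =>
    Set.mem_iInter₂.1 (hz' j.natAbs).2 j (by simp)⟩
  rw [boundedOrbits_eq_bot T hT, Submodule.mem_bot] at hmem
  have := (hz' 0).1
  simp [hmem] at this

lemma exists_exponential_expansion (T : E ≃ₗ[ℂ] E)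
    (hT : ∀ a : ℂ, Module.End.HasEigenvalue (T : E →ₗ[ℂ] E) a → ‖a‖ ≠ 1) :
    ∃ m : ℕ, ∀ (t : ℕ) (z : E), ∃ j : ℤ, |j| ≤ (m * t : ℕ) ∧ 2 ^ t * ‖z‖ ≤ ‖(T ^ j) z‖ := by
  obtain ⟨m, hm⟩ := exists_expansion T hT
  refine ⟨m, fun t => ?_⟩
  induction t with
  | zero => exact fun z => ⟨0, by simp, by simp⟩
  | succ t ih =>
    intro z
    obtain ⟨i, hi, hi'⟩ := hm z
    obtain ⟨j, hj, hj'⟩ := ih ((T ^ i) z)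
    refine ⟨j + i, (abs_add_le j i).trans ?_, ?_⟩
    · push_cast at hj ⊢
      linarith
    · rw [zpow_apply_add]
      refine le_trans ?_ hj'
      rw [pow_succ, mul_assoc]
      exact mul_le_mul_of_nonneg_left hi' (by positivity)

end Hyperbolic

/-! ### The orbit set spans -/

section Span

variable {k : ℕ}

lemma toRat_mulVec (A : Matrix (Fin k) (Fin k) ℤ) (x : Fin k → ℤ) :
    toRat (A.mulVec x) = (A.map (Int.cast : ℤ → ℚ)).mulVec (toRat x) := by
  ext i
  simp [toRat, Matrix.mulVec, dotProduct]

lemma toRat_pow_mulVec (A : Matrix (Fin k) (Fin k) ℤ) (m : ℕ) (x : Fin k → ℤ) :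
    toRat ((A ^ m).mulVec x) = ((A.map (Int.cast : ℤ → ℚ)) ^ m).mulVec (toRat x) := by
  rw [toRat_mulVec]
  congr 1
  exact map_pow (Int.castRingHom ℚ).mapMatrix A m

/-- Reducing `q` modulo the minimal polynomial leaves only powers of `A` below its degree. -/
lemma aeval_mulVec_mem_span (A : Matrix (Fin k) (Fin k) ℤ) (μ : PMF (Fin k → ℤ))
    (q : Polynomial ℚ) {x : Fin k → ℤ} (hx : x ∈ diffSet μ) :
    (Polynomial.aeval (A.map (Int.cast : ℤ → ℚ)) q).mulVec (toRat x) ∈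
      Submodule.span ℚ (toRat '' orbitSet A μ) := by
  set M := A.map (Int.cast : ℤ → ℚ)
  have hint : IsIntegral ℚ M := Algebra.IsIntegral.isIntegral M
  have hmonic := minpoly.monic hint
  rw [← Polynomial.aeval_modByMonic_eq_self_of_root (minpoly.aeval ℚ M) (p := q)]
  by_cases h1 : minpoly ℚ M = 1
  · simp [h1]
  rw [Polynomial.aeval_eq_sum_range' (Polynomial.natDegree_modByMonic_lt q hmonic h1),
    Matrix.sum_mulVec]
  refine Submodule.sum_mem _ fun i hi => ?_
  rw [Matrix.smul_mulVec, ← toRat_pow_mulVec]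
  exact Submodule.smul_mem _ _ (Submodule.subset_span
    ⟨_, ⟨x, hx, i, Finset.mem_range.1 hi, rfl⟩, rfl⟩)

/-- The span is `A`-invariant and contains all differences of support points, so the support is
parallel to it; by hypothesis it cannot be proper. -/
lemma span_orbitSet_eq_top (A : Matrix (Fin k) (Fin k) ℤ) (μ : PMF (Fin k → ℤ))
    (hμ : ∀ W : Submodule ℚ (Fin k → ℚ), W ≠ ⊤ → IsInvariant A W →
      ¬ IsParallelTo μ.support W) :
    Submodule.span ℚ (toRat '' orbitSet A μ) = ⊤ := by
  by_contra hne
  refine hμ _ hne ?_ ?_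
  · intro w hw
    induction hw using Submodule.span_induction with
    | mem y hy =>
      obtain ⟨_, ⟨x, hx, m, -, rfl⟩, rfl⟩ := hy
      have := aeval_mulVec_mem_span A μ (Polynomial.X ^ (m + 1)) hx
      rwa [Polynomial.aeval_X_pow, pow_succ', ← Matrix.mulVec_mulVec, ← toRat_pow_mulVec] at this
    | zero => simp
    | add x y _ _ hx hy => rw [Matrix.mulVec_add]; exact Submodule.add_mem _ hx hy
    | smul a x _ hx => rw [Matrix.mulVec_smul]; exact Submodule.smul_mem _ a hx
  · obtain ⟨l, hl⟩ := μ.support_nonempty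
    refine ⟨toRat l, fun h hh => ?_⟩
    have := aeval_mulVec_mem_span A μ 1 (x := h - l) ⟨h, hh, l, hl, rfl⟩
    rw [map_one, Matrix.one_mulVec] at this
    convert this using 1
    ext i
    simp [toRat]

lemma exists_isBasisMatrix (A : Matrix (Fin k) (Fin k) ℤ) (μ : PMF (Fin k → ℤ))
    (hμ : ∀ W : Submodule ℚ (Fin k → ℚ), W ≠ ⊤ → IsInvariant A W →
      ¬ IsParallelTo μ.support W) :
    ∃ B : Matrix (Fin k) (Fin k) ℤ, IsBasisMatrix A μ B := by
  have hspan := (span_orbitSet_eq_top A μ hμ).ge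
  let b := Module.Basis.ofSpan hspan
  let e := b.indexEquiv (Pi.basisFun ℚ (Fin k))
  let c := b.reindex e
  have hc : ∀ j, ∃ y ∈ orbitSet A μ, toRat y = c j := fun j => by
    obtain ⟨y, hy, h⟩ := Module.Basis.ofSpan_subset hspan (Set.mem_range_self (e.symm j))
    exact ⟨y, hy, h.trans (b.reindex_apply e j).symm⟩
  choose y hy hyc using hc
  have hB : (fun j => toRat fun i => (Matrix.of fun i j => y j i) i j) = c := funext hyc
  refine ⟨Matrix.of fun i j => y j i, hy, ?_, ?_⟩
  · rw [hB]; exact c.linearIndependent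
  · rw [hB]; exact c.span_eq

end Span

/-! ### Fourier analysis on `(ℤ/p)^k` -/

section Fourier

variable {k p : ℕ} [NeZero p]

/-- The standard character `x ↦ exp (2πi (α · x) / p)` of `(ℤ/p)^k`. -/
def character (α x : Fin k → ZMod p) : ℂ := ZMod.stdAddChar (α ⬝ᵥ x)

lemma norm_character (α x : Fin k → ZMod p) : ‖character α x‖ = 1 := by
  rw [character, ZMod.stdAddChar_apply, Circle.norm_coe]

lemma character_add_right (α x y : Fin k → ZMod p) :
    character α (x + y) = character α x * character α y := by
  rw [character, dotProduct_add, AddChar.map_add_eq_mul]; rfl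

lemma character_mulVec (M : Matrix (Fin k) (Fin k) (ZMod p)) (α x : Fin k → ZMod p) :
    character α (M.mulVec x) = character (M.transpose.mulVec α) x := by
  rw [character, character, Matrix.dotProduct_mulVec, Matrix.mulVec_transpose]

lemma conj_character (α x : Fin k → ZMod p) :
    (starRingEnd ℂ) (character α x) = character α (-x) := by
  rw [character, character, dotProduct_neg, AddChar.map_neg_eq_conj]

lemma sum_character (z : Fin k → ZMod p) :
    ∑ α, character α z = if z = 0 then (Fintype.card (Fin k → ZMod p) : ℂ) else 0 := by
  classical
  let ψ : AddChar (Fin k → ZMod p) ℂ :=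
    { toFun := fun α => character α z
      map_zero_eq_one' := by simp [character]
      map_add_eq_mul' := fun x y => by
        rw [character, add_dotProduct, AddChar.map_add_eq_mul]; rfl }
  have h : ψ = 0 ↔ z = 0 := by
    constructor
    · intro h
      ext i
      have h1 : ψ (Pi.single i 1) = 1 := by rw [h]; rfl
      have h2 : ZMod.stdAddChar (z i) = 1 := by simpa [ψ, character] using h1
      exact (AddChar.IsPrimitive.zmod_char_eq_one_iff p
        (ZMod.isPrimitive_stdAddChar p) (z i)).1 h2
    · rintro rfl
      ext α
      simp [ψ, character]
  have := AddChar.sum_eq_ite ψ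
  simp only [h] at this
  exact this

/-- The Fourier transform on `(ℤ/p)^k`. -/
def fourierSum (f : (Fin k → ZMod p) → ℂ) (α : Fin k → ZMod p) : ℂ := ∑ x, f x * character α x

lemma parseval (f : (Fin k → ZMod p) → ℂ) :
    ∑ α, ‖fourierSum f α‖ ^ 2 = Fintype.card (Fin k → ZMod p) * ∑ x, ‖f x‖ ^ 2 := by
  have h : ∀ z : ℂ, ((‖z‖ ^ 2 : ℝ) : ℂ) = z * (starRingEnd ℂ) z := fun z => by
    rw [Complex.mul_conj, Complex.normSq_eq_norm_sq]
  apply Complex.ofReal_injective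
  push_cast
  simp only [← Complex.ofReal_pow, h]
  calc ∑ α, fourierSum f α * (starRingEnd ℂ) (fourierSum f α)
      = ∑ α, ∑ x, ∑ y, f x * (starRingEnd ℂ) (f y) * character α (x - y) := by
        refine Finset.sum_congr rfl fun α _ => ?_
        rw [fourierSum, map_sum, Finset.sum_mul_sum]
        refine Finset.sum_congr rfl fun x _ => Finset.sum_congr rfl fun y _ => ?_
        rw [map_mul, conj_character, sub_eq_add_neg, character_add_right]
        ring
    _ = ∑ x, ∑ y, f x * (starRingEnd ℂ) (f y) * ∑ α, character α (x - y) := by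
        rw [Finset.sum_comm]
        refine Finset.sum_congr rfl fun x _ => ?_
        rw [Finset.sum_comm]
        simp only [Finset.mul_sum]
    _ = _ := by
        simp only [sum_character, sub_eq_zero, mul_ite, mul_zero, Finset.sum_ite_eq,
          Finset.mem_univ, if_true]
        rw [Finset.mul_sum]
        exact Finset.sum_congr rfl fun x _ => mul_comm _ _

/-- The upper bound lemma for the distance to the uniform distribution. -/
lemma tvDist_uniformMass_sq_le (f : (Fin k → ZMod p) → ℝ) (hf : ∑ x, f x = 1) :
    tvDist f (uniformMass (Fin k → ZMod p)) ^ 2 ≤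
      1 / 4 * ∑ α ∈ Finset.univ.erase 0, ‖fourierSum (fun x => (f x : ℂ)) α‖ ^ 2 := by
  set N : ℝ := (Fintype.card (Fin k → ZMod p) : ℝ) with hN
  have hN0 : N ≠ 0 := by rw [hN]; exact Nat.cast_ne_zero.2 Fintype.card_ne_zero
  -- Subtracting the uniform mass kills the coefficient at 0 and changes no other; Cauchy–Schwarz
  -- and Parseval finish.
  set g : (Fin k → ZMod p) → ℂ := fun x => ((f x - 1 / N : ℝ) : ℂ) with hg
  have hg0 : fourierSum g 0 = 0 := by
    simp only [fourierSum, character, zero_dotProduct, AddChar.map_zero_eq_one, mul_one, hg]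
    rw [← Complex.ofReal_sum, Finset.sum_sub_distrib, hf, Finset.sum_const, Finset.card_univ,
      nsmul_eq_mul, ← hN, mul_one_div_cancel hN0, sub_self, Complex.ofReal_zero]
  have hgα : ∀ α ≠ 0, fourierSum g α = fourierSum (fun x => (f x : ℂ)) α := fun α hα => by
    have h0 : ∑ x, character α x = 0 := by
      have : ∀ x, character α x = character x α := fun x => by
        rw [character, character, dotProduct_comm]
      simp only [this, sum_character, hα, if_false]
    simp only [fourierSum, hg, Complex.ofReal_sub, sub_mul, Finset.sum_sub_distrib]
    rw [← Finset.mul_sum, h0, mul_zero, sub_zero]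
  have hcs : (∑ x, |f x - 1 / N|) ^ 2 ≤ N * ∑ x, |f x - 1 / N| ^ 2 := by
    have := sq_sum_le_card_mul_sum_sq (s := Finset.univ) (f := fun x => |f x - 1 / N|)
    simpa [hN] using this
  have hpar := parseval g
  rw [← Finset.add_sum_erase _ _ (Finset.mem_univ 0), hg0] at hpar
  have hsum : ∑ α ∈ Finset.univ.erase 0, ‖fourierSum (fun x => (f x : ℂ)) α‖ ^ 2 =
      N * ∑ x, |f x - 1 / N| ^ 2 := by
    rw [Finset.sum_congr rfl fun α hα => by rw [← hgα α (Finset.ne_of_mem_erase hα)]]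
    have hnorm : ∀ x, ‖g x‖ = |f x - 1 / N| := fun x => Complex.norm_real _
    simp only [hnorm, norm_zero] at hpar
    linarith
  rw [hsum, tvDist, mul_pow]
  have : (1 / 2 : ℝ) ^ 2 = 1 / 4 := by norm_num
  rw [this]
  exact mul_le_mul_of_nonneg_left hcs (by norm_num)

end Fourier

/-! ### Fourier transform of `μ` near modulus 1 -/

section CharFun

variable {k : ℕ}

/-- The Fourier transform of `μ` reduced modulo `p`. -/
def charFunMod (μ : PMF (Fin k → ℤ)) (p : ℕ) [NeZero p] (β : Fin k → ZMod p) : ℂ :=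
  ∫ y, character β (toZMod p y) ∂μ.toMeasure

lemma norm_charFunMod_le_one (μ : PMF (Fin k → ℤ)) (p : ℕ) [NeZero p] (β : Fin k → ZMod p) :
    ‖charFunMod μ p β‖ ≤ 1 := by
  refine (norm_integral_le_of_norm_le_const (C := 1) (ae_of_all _ fun y => ?_)).trans ?_
  · exact (norm_character _ _).le
  · simp

/-- The squared norm is `(a + b)² - 2ab(1 - cos θ) ≤ (a + b)² - 16abη²`, which is at most the square
of the right-hand side. -/
lemma norm_add_mul_exp_le {a b η θ : ℝ} (ha : 0 < a) (hb : 0 < b) (hη : η ^ 2 ≤ 1 / 4)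
    (hθ : Real.cos θ ≤ 1 - 8 * η ^ 2) :
    ‖(a : ℂ) * Complex.exp (θ * Complex.I) + b‖ ≤ a + b - 8 * a * b * η ^ 2 / (a + b) := by
  have hab : 0 < a + b := by positivity
  have h1 : 8 * a * b * η ^ 2 / (a + b) ≤ a + b := by
    rw [div_le_iff₀ hab]
    nlinarith [mul_pos ha hb, sq_nonneg (a - b), sq_nonneg (a + b)]
  refine abs_le_of_sq_le_sq' ?_ (by linarith) |>.2
  have h2 : ‖(a : ℂ) * Complex.exp (θ * Complex.I) + b‖ ^ 2 =
      a ^ 2 + b ^ 2 + 2 * (a * b) * Real.cos θ := by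
    rw [← Complex.normSq_eq_norm_sq, Complex.normSq_apply]
    simp only [Complex.add_re, Complex.add_im, Complex.re_ofReal_mul, Complex.im_ofReal_mul,
      Complex.exp_ofReal_mul_I_re, Complex.exp_ofReal_mul_I_im, Complex.ofReal_re,
      Complex.ofReal_im]
    linear_combination a ^ 2 * Real.sin_sq_add_cos_sq θ
  have h3 : (a + b) * (8 * a * b * η ^ 2 / (a + b)) = 8 * a * b * η ^ 2 := by
    field_simp
  rw [h2]
  nlinarith [mul_le_mul_of_nonneg_left hθ (mul_pos ha hb).le,
    sq_nonneg (8 * a * b * η ^ 2 / (a + b))]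

lemma stdAddChar_eq_exp_valMinAbs {p : ℕ} [NeZero p] (u : ZMod p) :
    ZMod.stdAddChar u =
      Complex.exp ((2 * Real.pi * (u.valMinAbs / p) : ℝ) * Complex.I) := by
  conv_lhs => rw [← ZMod.coe_valMinAbs u, ZMod.stdAddChar_coe]
  congr 1
  push_cast
  ring

lemma cos_valMinAbs_le {p : ℕ} [NeZero p] (u : ZMod p) {η : ℝ} (hη : 0 ≤ η)
    (h : η * p ≤ |(u.valMinAbs : ℝ)|) :
    Real.cos (2 * Real.pi * (u.valMinAbs / p)) ≤ 1 - 8 * η ^ 2 := by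
  have hp : (0 : ℝ) < p := Nat.cast_pos.2 (NeZero.pos p)
  have hhalf : |(u.valMinAbs : ℝ) / p| ≤ 1 / 2 := by
    have := u.valMinAbs_mem_Ioc
    have h1 : (-(p : ℝ)) < u.valMinAbs * 2 := by exact_mod_cast this.1
    have h2 : (u.valMinAbs : ℝ) * 2 ≤ p := by exact_mod_cast this.2
    rw [abs_div, abs_of_pos hp, div_le_iff₀ hp, abs_le]
    constructor <;> linarith
  have hη' : η ≤ |(u.valMinAbs : ℝ) / p| := by
    rwa [abs_div, abs_of_pos hp, le_div_iff₀ hp]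
  have hcos := Real.cos_le_one_sub_mul_cos_sq (x := 2 * Real.pi * (u.valMinAbs / p)) (by
    rw [abs_mul, abs_of_pos (by positivity)]
    nlinarith [Real.pi_pos])
  refine hcos.trans ?_
  have h1 : 2 / Real.pi ^ 2 * (2 * Real.pi * ((u.valMinAbs : ℝ) / p)) ^ 2 =
      8 * |(u.valMinAbs : ℝ) / p| ^ 2 := by
    rw [sq_abs]
    field_simp
    ring
  rw [h1]
  nlinarith

/-- Isolate the atoms at `h` and `l`, bound the rest by its mass, and factor out the unimodular
character value at `l`. -/
lemma norm_charFunMod_le (μ : PMF (Fin k → ℤ)) (p : ℕ) [NeZero p] (β : Fin k → ZMod p)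
    {h l : Fin k → ℤ} (hne : h ≠ l) :
    ‖charFunMod μ p β‖ ≤ 1 - (μ h).toReal - (μ l).toReal +
      ‖((μ h).toReal : ℂ) * ZMod.stdAddChar (β ⬝ᵥ toZMod p (h - l)) + (μ l).toReal‖ := by
  set g : (Fin k → ℤ) → ℂ := fun y => character β (toZMod p y) with hg
  have hg1 : ∀ y, ‖g y‖ = 1 := fun y => norm_character _ _
  have hint : Integrable g μ.toMeasure :=
    Integrable.of_bound (measurable_of_countable g).aestronglyMeasurable 1
      (ae_of_all _ fun y => (hg1 y).le)
  have hreal : ∀ y, μ.toMeasure.real {y} = (μ y).toReal := fun y => by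
    rw [measureReal_def, PMF.toMeasure_apply_singleton _ _ (measurableSet_singleton y)]
  set s : Finset (Fin k → ℤ) := {h, l} with hs
  have hs1 : μ.toMeasure.real s = (μ h).toReal + (μ l).toReal := by
    rw [← sum_measureReal_singleton, hs, Finset.sum_pair hne, hreal, hreal]
  have hsplit : charFunMod μ p β = (∫ y in s, g y ∂μ.toMeasure) +
      ∫ y in (s : Set (Fin k → ℤ))ᶜ, g y ∂μ.toMeasure :=
    (integral_add_compl s.measurableSet hint).symm
  have hfst : ∫ y in s, g y ∂μ.toMeasure =
      g l * ((μ h).toReal * ZMod.stdAddChar (β ⬝ᵥ toZMod p (h - l)) + (μ l).toReal) := by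
    rw [setIntegral_finset _ hint.integrableOn, hs, Finset.sum_pair hne, hreal, hreal]
    have : toZMod p h = toZMod p l + toZMod p (h - l) := by
      ext i; simp [toZMod]
    simp only [Complex.real_smul, hg]
    rw [this, character_add_right]
    simp only [character]
    ring
  have hsnd : ‖∫ y in (s : Set (Fin k → ℤ))ᶜ, g y ∂μ.toMeasure‖ ≤
      1 - ((μ h).toReal + (μ l).toReal) := by
    refine (norm_setIntegral_le_of_norm_le_const (C := 1) (measure_lt_top _ _)
      fun y _ => (hg1 y).le).trans ?_
    rw [one_mul, probReal_compl_eq_one_sub s.measurableSet, hs1]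
  rw [hsplit]
  refine (norm_add_le _ _).trans ?_
  rw [hfst, norm_mul, hg1, one_mul]
  linarith

/-- The point is uniformity: `δ` does not depend on `p` or `β`. -/
lemma exists_gap (μ : PMF (Fin k → ℤ)) {h l : Fin k → ℤ} (hh : h ∈ μ.support)
    (hl : l ∈ μ.support) {η : ℝ} (hη0 : 0 < η) (hη : η ≤ 1 / 2) :
    ∃ δ : ℝ, 0 < δ ∧ ∀ (p : ℕ) [NeZero p] (β : Fin k → ZMod p),
      1 - δ < ‖charFunMod μ p β‖ →
        |((β ⬝ᵥ toZMod p (h - l)).valMinAbs : ℝ)| < η * p := by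
  rcases eq_or_ne h l with rfl | hne
  · refine ⟨1, one_pos, fun p _ β _ => ?_⟩
    have : toZMod p (h - h) = 0 := by ext i; simp [toZMod]
    have hp : (0 : ℝ) < p := Nat.cast_pos.2 (NeZero.pos p)
    simp only [this, dotProduct_zero, ZMod.valMinAbs_zero, Int.cast_zero, abs_zero]
    positivity
  have hpos : ∀ y ∈ μ.support, 0 < (μ y).toReal := fun y hy =>
    ENNReal.toReal_pos ((μ.mem_support_iff y).1 hy) (μ.apply_ne_top y)
  have ha := hpos h hh
  have hb := hpos l hl
  refine ⟨8 * (μ h).toReal * (μ l).toReal * η ^ 2 / ((μ h).toReal + (μ l).toReal),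
    by positivity, fun p _ β hβ => ?_⟩
  by_contra! hcon
  have h1 := norm_charFunMod_le μ p β hne
  rw [stdAddChar_eq_exp_valMinAbs] at h1
  have h2 := norm_add_mul_exp_le ha hb (by nlinarith : η ^ 2 ≤ 1 / 4)
    (cos_valMinAbs_le _ hη0.le hcon)
  linarith

end CharFun

/-! ### Product formula for the chain -/

section ChainFourier

variable {k : ℕ} {Ω : Type*}

/-- The action on frequencies dual to the chain. -/
def dualMatrix (p : ℕ) (A : Matrix (Fin k) (Fin k) ℤ) : Matrix (Fin k) (Fin k) (ZMod p) :=
  (A.map (Int.cast : ℤ → ZMod p)).transpose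

lemma character_chain (p : ℕ) [NeZero p] (A : Matrix (Fin k) (Fin k) ℤ) (x₀ : Fin k → ℤ)
    (b : ℕ → Ω → (Fin k → ℤ)) (n : ℕ) (α : Fin k → ZMod p) (ω : Ω) :
    character α (chain p A x₀ b n ω) =
      character ((dualMatrix p A ^ n).mulVec α) (toZMod p x₀) *
        ∏ j ∈ Finset.range n,
          character ((dualMatrix p A ^ (n - 1 - j)).mulVec α) (toZMod p (b j ω)) := by
  induction n generalizing α with
  | zero => simp [chain]
  | succ n ih =>
    have hstep : ∀ m, (dualMatrix p A ^ m).mulVec ((dualMatrix p A).mulVec α) =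
        (dualMatrix p A ^ (m + 1)).mulVec α := fun m => by
      rw [Matrix.mulVec_mulVec, pow_succ]
    rw [chain, character_add_right, character_mulVec, ← dualMatrix, ih, hstep,
      Finset.prod_range_succ, mul_assoc]
    congr 2
    · refine Finset.prod_congr rfl fun j hj => ?_
      have := Finset.mem_range.1 hj
      rw [hstep, show n - 1 - j + 1 = n + 1 - 1 - j by omega]
    · simp

variable [MeasurableSpace Ω] {P : Measure Ω} {b : ℕ → Ω → (Fin k → ℤ)} {μ : PMF (Fin k → ℤ)}

lemma exists_measurable_chain_lift (hb : IsIIDWithLaw P b μ) (p : ℕ) (A : Matrix (Fin k) (Fin k) ℤ)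
    (x₀ : Fin k → ℤ) (n : ℕ) :
    ∃ Y : Ω → (Fin k → ℤ), Measurable Y ∧ ∀ ω, chain p A x₀ b n ω = toZMod p (Y ω) := by
  induction n with
  | zero => exact ⟨fun _ => x₀, measurable_const, fun _ => rfl⟩
  | succ n ih =>
    obtain ⟨Y, hY, hYc⟩ := ih
    refine ⟨fun ω => A.mulVec (Y ω) + b n ω,
      ((measurable_of_countable fun y => A.mulVec y).comp hY).add (hb.measurable n), fun ω => ?_⟩
    simp only [chain, hYc]
    ext i
    simp [toZMod, Matrix.mulVec, dotProduct]

lemma measurableSet_chain (hb : IsIIDWithLaw P b μ) (p : ℕ) (A : Matrix (Fin k) (Fin k) ℤ)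
    (x₀ : Fin k → ℤ) (n : ℕ) (x : Fin k → ZMod p) :
    MeasurableSet {ω | chain p A x₀ b n ω = x} := by
  obtain ⟨Y, hY, hYc⟩ := exists_measurable_chain_lift hb p A x₀ n
  have : {ω | chain p A x₀ b n ω = x} = Y ⁻¹' {y | toZMod p y = x} := by
    ext ω; simp [hYc]
  rw [this]
  exact hY (Set.to_countable _).measurableSet

lemma map_eq_toMeasure (hb : IsIIDWithLaw P b μ) (n : ℕ) : P.map (b n) = μ.toMeasure := by
  refine Measure.ext_of_singleton fun x => ?_
  rw [Measure.map_apply (hb.measurable n) (measurableSet_singleton x),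
    PMF.toMeasure_apply_singleton _ _ (measurableSet_singleton x)]
  exact hb.law n x

variable [IsProbabilityMeasure P]

lemma sum_chainLaw_mul (hb : IsIIDWithLaw P b μ) (p : ℕ) [NeZero p]
    (A : Matrix (Fin k) (Fin k) ℤ) (x₀ : Fin k → ℤ) (n : ℕ) (g : (Fin k → ZMod p) → ℂ) :
    ∑ x, (chainLaw P p A x₀ b n x : ℂ) * g x = ∫ ω, g (chain p A x₀ b n ω) ∂P := by
  classical
  have hms := measurableSet_chain hb p A x₀ n
  have h : ∀ ω, g (chain p A x₀ b n ω) =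
      ∑ x, {ω | chain p A x₀ b n ω = x}.indicator (fun _ => g x) ω := fun ω => by
    simp [Set.indicator_apply]
  simp only [h]
  rw [integral_finsetSum _ fun x _ => (integrable_const _).indicator (hms x)]
  refine Finset.sum_congr rfl fun x _ => ?_
  rw [integral_indicator_const _ (hms x), Complex.real_smul]
  rfl

lemma sum_chainLaw (hb : IsIIDWithLaw P b μ) (p : ℕ) [NeZero p]
    (A : Matrix (Fin k) (Fin k) ℤ) (x₀ : Fin k → ℤ) (n : ℕ) :
    ∑ x, chainLaw P p A x₀ b n x = 1 := by
  have := sum_chainLaw_mul hb p A x₀ n fun _ => 1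
  simp only [mul_one, integral_const, probReal_univ, one_smul] at this
  exact_mod_cast this

lemma norm_fourierSum_chainLaw (hb : IsIIDWithLaw P b μ) (p : ℕ) [NeZero p]
    (A : Matrix (Fin k) (Fin k) ℤ) (x₀ : Fin k → ℤ) (n : ℕ) (α : Fin k → ZMod p) :
    ‖fourierSum (fun x => (chainLaw P p A x₀ b n x : ℂ)) α‖ =
      ∏ j ∈ Finset.range n, ‖charFunMod μ p ((dualMatrix p A ^ j).mulVec α)‖ := by
  rw [fourierSum, sum_chainLaw_mul hb]
  simp only [character_chain]
  rw [integral_const_mul, norm_mul, norm_character, one_mul]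
  simp only [Finset.prod_range]
  have hind : iIndepFun (fun j : Fin n => b j) P := hb.indep.precomp Fin.val_injective
  rw [hind.integral_fun_prod_comp (f := fun (j : Fin n) y =>
      character ((dualMatrix p A ^ (n - 1 - (j : ℕ))).mulVec α) (toZMod p y))
    (fun j => (hb.measurable j).aemeasurable)
    (fun j => (measurable_of_countable _).aestronglyMeasurable), norm_prod]
  have : ∀ (j : ℕ) (β : Fin k → ZMod p),
      ∫ ω, character β (toZMod p (b j ω)) ∂P = charFunMod μ p β := fun j β => by
    rw [charFunMod, ← map_eq_toMeasure hb j, integral_map (hb.measurable j).aemeasurable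
      (measurable_of_countable _).aestronglyMeasurable]
  simp only [this]
  -- The increment `b j` is carried by `A ^ (n - 1 - j)`, so the product appears in reversed order.
  rw [← Finset.prod_range fun j => ‖charFunMod μ p ((dualMatrix p A ^ j).mulVec α)‖,
    ← Finset.prod_range_reflect, Finset.prod_range]

end ChainFourier

/-! ### Integral orbits and lifting from residues -/

section Lattice

variable {k : ℕ}

lemma eigenvalue_transpose {M : Matrix (Fin k) (Fin k) ℂ} {a : ℂ}
    (h : Module.End.HasEigenvalue (Matrix.toLin' M.transpose) a) :
    Module.End.HasEigenvalue (Matrix.toLin' M) a := by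
  rw [Module.End.hasEigenvalue_iff_mem_spectrum, Matrix.spectrum_toLin',
    Matrix.mem_spectrum_iff_isRoot_charpoly] at h ⊢
  rwa [Matrix.charpoly_transpose] at h

/-- An integer vector, viewed in `ℂ^k`. -/
def toComplex (x : Fin k → ℤ) : Fin k → ℂ := fun i => (x i : ℂ)

lemma one_le_norm_toComplex {x : Fin k → ℤ} (hx : x ≠ 0) : 1 ≤ ‖toComplex x‖ := by
  obtain ⟨i, hi⟩ := Function.ne_iff.1 hx
  refine le_trans ?_ (norm_le_pi_norm (toComplex x) i)
  rw [toComplex, Complex.norm_intCast]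
  exact_mod_cast Int.one_le_abs hi

/-- A nonzero integral orbit segment of a hyperbolic matrix has exponentially large entries. -/
lemma exists_large_entry (A : Matrix (Fin k) (Fin k) ℤ)
    (hA : ∀ z : ℂ, Module.End.HasEigenvalue (Matrix.toLin' (A.map (Int.cast : ℤ → ℂ))) z →
      z ≠ 0 ∧ ‖z‖ ≠ 1) :
    ∃ m : ℕ, ∀ (t : ℕ) (w : ℕ → Fin k → ℤ), w 0 ≠ 0 →
      (∀ j < 2 * (m * t), w (j + 1) = A.transpose.mulVec (w j)) →
      ∃ j ≤ 2 * (m * t), ∃ i, 2 ^ t ≤ |w j i| := by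
  set M : Matrix (Fin k) (Fin k) ℂ := A.map (Int.cast : ℤ → ℂ)
  have hM : ∀ z : ℂ, Module.End.HasEigenvalue (Matrix.toLin' M.transpose) z → z ≠ 0 ∧ ‖z‖ ≠ 1 :=
    fun z hz => hA z (eigenvalue_transpose hz)
  have hinj : Function.Injective (Matrix.toLin' M.transpose) := by
    rw [← LinearMap.ker_eq_bot]
    by_contra hne
    refine (hM 0 ?_).1 rfl
    rwa [Module.End.hasEigenvalue_iff, Module.End.eigenspace_zero]
  let T : (Fin k → ℂ) ≃ₗ[ℂ] (Fin k → ℂ) := LinearEquiv.ofInjectiveEndo _ hinj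
  have hTc : (T : (Fin k → ℂ) →ₗ[ℂ] (Fin k → ℂ)) = Matrix.toLin' M.transpose := rfl
  have hT : ∀ x : Fin k → ℤ, T (toComplex x) = toComplex (A.transpose.mulVec x) := fun x => by
    change Matrix.toLin' M.transpose (toComplex x) = _
    ext i
    simp [toComplex, M, Matrix.mulVec, dotProduct]
  obtain ⟨m, hm⟩ := exists_exponential_expansion T fun a ha => (hM a (hTc ▸ ha)).2
  refine ⟨m, fun t w hw0 hw => ?_⟩
  have hpow : ∀ j : ℕ, j ≤ 2 * (m * t) → (T ^ (j : ℤ)) (toComplex (w 0)) = toComplex (w j) := by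
    intro j
    induction j with
    | zero => intro _; simp
    | succ j ih =>
      intro hj
      rw [Nat.cast_succ, add_comm, zpow_apply_add, zpow_one, ih (by omega), hT, hw j (by omega)]
  have hwne : w (m * t) ≠ 0 := by
    intro h0
    have h1 := hpow (m * t) (by omega)
    have h2 : toComplex (w (m * t)) = 0 := by rw [h0]; ext i; simp [toComplex]
    rw [h2, LinearEquiv.map_eq_zero_iff] at h1
    refine hw0 (funext fun i => ?_)
    simpa [toComplex] using congrFun h1 i
  -- Expansion may occur forwards or backwards, so it is applied at the midpoint of the segment,
  -- where a nonzero integer vector has norm at least 1.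
  obtain ⟨i, hi, hle⟩ := hm t (toComplex (w (m * t)))
  obtain ⟨hi1, hi2⟩ := abs_le.1 hi
  obtain ⟨j, hj⟩ := Int.eq_ofNat_of_zero_le (a := i + (m * t : ℕ)) (by linarith)
  have hj' : j ≤ 2 * (m * t) := by omega
  rw [← hpow (m * t) (by omega), ← zpow_apply_add, hj, hpow j hj', hpow (m * t) (by omega)] at hle
  refine ⟨j, hj', ?_⟩
  by_contra! hcon
  have hlt : ‖toComplex (w j)‖ < 2 ^ t := by
    refine (pi_norm_lt_iff (by positivity)).2 fun l => ?_
    rw [toComplex, Complex.norm_intCast]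
    exact_mod_cast hcon l
  have := one_le_norm_toComplex hwne
  have h2 : (0 : ℝ) < 2 ^ t := by positivity
  nlinarith

/-- The sum of the absolute values of the entries. -/
def entrySum (M : Matrix (Fin k) (Fin k) ℤ) : ℝ := ∑ i, ∑ j, |(M i j : ℝ)|

lemma entrySum_nonneg (M : Matrix (Fin k) (Fin k) ℤ) : 0 ≤ entrySum M :=
  Finset.sum_nonneg fun _ _ => Finset.sum_nonneg fun _ _ => abs_nonneg _

lemma abs_mulVec_le (M : Matrix (Fin k) (Fin k) ℤ) {x : Fin k → ℤ} {c : ℝ} (hc : 0 ≤ c)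
    (hx : ∀ j, |(x j : ℝ)| ≤ c) (i : Fin k) : |(M.mulVec x i : ℝ)| ≤ entrySum M * c := by
  have h1 : |(M.mulVec x i : ℝ)| ≤ (∑ j, |(M i j : ℝ)|) * c := by
    rw [Matrix.mulVec, dotProduct, Finset.sum_mul]
    push_cast
    refine (Finset.abs_sum_le_sum_abs _ _).trans (Finset.sum_le_sum fun j _ => ?_)
    rw [abs_mul]
    exact mul_le_mul_of_nonneg_left (hx j) (abs_nonneg _)
  refine h1.trans (mul_le_mul_of_nonneg_right ?_ hc)
  exact Finset.single_le_sum (f := fun i => ∑ j, |(M i j : ℝ)|)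
    (fun _ _ => Finset.sum_nonneg fun _ _ => abs_nonneg _) (Finset.mem_univ i)

lemma toZMod_mulVec (p : ℕ) (M : Matrix (Fin k) (Fin k) ℤ) (x : Fin k → ℤ) :
    toZMod p (M.mulVec x) = (M.map (Int.cast : ℤ → ZMod p)).mulVec (toZMod p x) := by
  ext i
  simp [toZMod, Matrix.mulVec, dotProduct]

lemma dotProduct_toZMod_pow_mulVec (p : ℕ) (A : Matrix (Fin k) (Fin k) ℤ) (β : Fin k → ZMod p)
    (m : ℕ) (v : Fin k → ℤ) :
    β ⬝ᵥ toZMod p ((A ^ m).mulVec v) = (dualMatrix p A ^ m).mulVec β ⬝ᵥ toZMod p v := by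
  have h : (A ^ m).map (Int.cast : ℤ → ZMod p) = A.map (Int.cast : ℤ → ZMod p) ^ m :=
    map_pow (Int.castRingHom (ZMod p)).mapMatrix A m
  rw [toZMod_mulVec, h, Matrix.dotProduct_mulVec, dualMatrix, ← Matrix.transpose_pow,
    Matrix.mulVec_transpose]

lemma isUnit_intCast_of_gcd {D : ℤ} {p : ℕ} (h : Int.gcd D p = 1) : IsUnit (D : ZMod p) :=
  (ZMod.coe_int_isUnit_iff_isCoprime D p).2 (Int.isCoprime_iff_gcd_eq_one.2 h).symm

lemma dualMatrix_pow_mulVec_ne_zero {p : ℕ} {A : Matrix (Fin k) (Fin k) ℤ}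
    (hA : Int.gcd A.det p = 1) {α : Fin k → ZMod p} (hα : α ≠ 0) (n : ℕ) :
    (dualMatrix p A ^ n).mulVec α ≠ 0 := by
  have hdet : IsUnit (dualMatrix p A ^ n) := by
    refine IsUnit.pow n ((Matrix.isUnit_iff_isUnit_det _).2 ?_)
    rw [dualMatrix, Matrix.det_transpose]
    have : (A.map (Int.cast : ℤ → ZMod p)).det = (A.det : ZMod p) :=
      ((Int.castRingHom (ZMod p)).map_det A).symm
    rw [this]
    exact isUnit_intCast_of_gcd hA
  intro h
  exact hα (Matrix.mulVec_injective_of_isUnit hdet (by rw [h, Matrix.mulVec_zero]))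

/-- Among the first few dual iterates of a nonzero frequency, one is far from being orthogonal
modulo `p` to one of the vectors whose iterates form the columns of `B`. -/
lemma exists_far_iterate (A B : Matrix (Fin k) (Fin k) ℤ)
    (hA : ∀ z : ℂ, Module.End.HasEigenvalue (Matrix.toLin' (A.map (Int.cast : ℤ → ℂ))) z →
      z ≠ 0 ∧ ‖z‖ ≠ 1) (d : ℕ) (e : Fin k → ℕ) (he : ∀ i, e i < d) (v : Fin k → Fin k → ℤ)
    (hB : ∀ i, (fun j => B j i) = (A ^ e i).mulVec (v i)) :
    ∃ η : ℝ, 0 < η ∧ η ≤ 1 / 2 ∧ ∃ m : ℕ, ∀ (p t : ℕ) [NeZero p], p < 2 ^ t →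
      Int.gcd B.det p = 1 → ∀ α : Fin k → ZMod p, α ≠ 0 →
        ∃ j < 2 * (m * t) + d + 1, ∃ i,
          η * p ≤ |(((dualMatrix p A ^ j).mulVec α ⬝ᵥ toZMod p (v i)).valMinAbs : ℝ)| := by
  obtain ⟨m, hm⟩ := exists_large_entry A hA
  set C₁ := entrySum B.transpose.adjugate
  set C₂ := entrySum A.transpose
  have hC₁ : 0 ≤ C₁ := entrySum_nonneg _
  have hC₂ : 0 ≤ C₂ := entrySum_nonneg _
  -- Chosen so that `C₁ η p + C₂ C₁ η p < p`, which upgrades congruences to equalities, and `C₁ η p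
  -- ≤ p / 2`, which contradicts growth beyond `2 ^ t > p`.
  set η : ℝ := 1 / (2 * ((1 + C₁) * (1 + C₂))) with hη
  have hηpos : 0 < η := by positivity
  have hη1 : η * ((1 + C₁) * (1 + C₂)) = 1 / 2 := by rw [hη]; field_simp
  refine ⟨η, hηpos, by nlinarith [mul_nonneg hC₁ hC₂], m, fun p t _ hpt hgcd α hα => ?_⟩
  by_contra! hcon
  have hp : (0 : ℝ) < p := Nat.cast_pos.2 (NeZero.pos p)
  let β : ℕ → Fin k → ZMod p := fun j => (dualMatrix p A ^ j).mulVec α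
  let s : ℕ → Fin k → ℤ := fun j i => (β j ⬝ᵥ toZMod p fun l => B l i).valMinAbs
  let w : ℕ → Fin k → ℤ := fun j => B.transpose.adjugate.mulVec (s j)
  have hs : ∀ j ≤ 2 * (m * t), ∀ i, |(s j i : ℝ)| ≤ η * p := fun j hj i => by
    -- Moving `A ^ e i` to the frequency side costs `e i < d` further iterates, whence the `d` in
    -- the window length.
    have h1 : s j i = ((dualMatrix p A ^ (e i + j)).mulVec α ⬝ᵥ toZMod p (v i)).valMinAbs := by
      simp only [s, β]
      rw [hB, dotProduct_toZMod_pow_mulVec, Matrix.mulVec_mulVec, pow_add]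
    rw [h1]
    exact (hcon _ (by have := he i; omega) i).le
  have hw : ∀ j ≤ 2 * (m * t), ∀ i, |(w j i : ℝ)| ≤ C₁ * (η * p) := fun j hj =>
    abs_mulVec_le _ (by positivity) (hs j hj)
  have hwmod : ∀ j, toZMod p (w j) = (B.det : ZMod p) • β j := fun j => by
    have h1 : toZMod p (s j) = (B.transpose.map (Int.cast : ℤ → ZMod p)).mulVec (β j) := by
      ext i
      simp only [toZMod, s, ZMod.coe_valMinAbs, Matrix.mulVec]
      rw [dotProduct_comm]
      rfl
    have h2 : B.transpose.adjugate.map (Int.cast : ℤ → ZMod p) *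
        B.transpose.map (Int.cast : ℤ → ZMod p) = (B.det : ZMod p) • 1 := by
      have := congrArg (Int.castRingHom (ZMod p)).mapMatrix (Matrix.adjugate_mul B.transpose)
      rw [map_mul, Matrix.det_transpose, map_zsmul, map_one, ← Int.cast_smul_eq_zsmul (ZMod p)] at this
      exact this
    rw [toZMod_mulVec, h1, Matrix.mulVec_mulVec, h2, Matrix.smul_mulVec, Matrix.one_mulVec]
  have hstep : ∀ j < 2 * (m * t), w (j + 1) = A.transpose.mulVec (w j) := fun j hj => by
    ext i
    rw [← sub_eq_zero]
    refine Int.eq_zero_of_abs_lt_dvd (m := p) ?_ ?_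
    · rw [← ZMod.intCast_zmod_eq_zero_iff_dvd, Int.cast_sub, sub_eq_zero]
      change toZMod p (w (j + 1)) i = toZMod p (A.transpose.mulVec (w j)) i
      rw [hwmod (j + 1), toZMod_mulVec, hwmod j, Matrix.mulVec_smul]
      simp only [β]
      rw [pow_succ', ← Matrix.mulVec_mulVec]
      rfl
    · have h1 := hw (j + 1) hj i
      have h2 := abs_mulVec_le A.transpose (by positivity) (hw j hj.le) i
      have h3 : |((w (j + 1) i - A.transpose.mulVec (w j) i : ℤ) : ℝ)| < p := by
        push_cast
        refine (abs_sub _ _).trans_lt ?_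
        calc _ ≤ C₁ * (η * p) + C₂ * (C₁ * (η * p)) := add_le_add h1 h2
          _ ≤ (η * ((1 + C₁) * (1 + C₂))) * p := by
            nlinarith [mul_nonneg (mul_nonneg hηpos.le hC₂) hp.le, mul_nonneg hηpos.le hp.le]
          _ < p := by rw [hη1]; linarith
      exact_mod_cast h3
  have hw0 : w 0 ≠ 0 := by
    intro h0
    have h1 := hwmod 0
    have h2 : toZMod p (w 0) = 0 := by rw [h0]; ext i; simp [toZMod]
    rw [h2, eq_comm, (isUnit_intCast_of_gcd hgcd).smul_eq_zero] at h1
    simp only [β, pow_zero, Matrix.one_mulVec] at h1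
    exact hα h1
  obtain ⟨j, hj, i, hi⟩ := hm t w hw0 hstep
  have h1 : ((2 : ℝ) ^ t) ≤ |(w j i : ℝ)| := by exact_mod_cast hi
  have h2 : (p : ℝ) < 2 ^ t := by exact_mod_cast hpt
  have h3 : C₁ * (η * p) ≤ (η * ((1 + C₁) * (1 + C₂))) * p := by
    nlinarith [mul_nonneg (mul_nonneg hηpos.le hC₂) hp.le, mul_nonneg hηpos.le hp.le,
      mul_nonneg (mul_nonneg (mul_nonneg hηpos.le hC₂) hp.le) hC₁]
  rw [hη1] at h3
  linarith [hw j hj i]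

end Lattice

/-! ### Products over blocks -/

section Counting

lemma prod_range_le_pow {f : ℕ → ℝ} (hf0 : ∀ j, 0 ≤ f j) (hf1 : ∀ j, f j ≤ 1) {r : ℝ} {L : ℕ}
    (h : ∀ s, ∃ j < L, f (s + j) ≤ r) (n : ℕ) :
    ∏ j ∈ Finset.range n, f j ≤ r ^ (n / L) := by
  have hr : 0 ≤ r := by
    obtain ⟨j, -, hj⟩ := h 0
    exact (hf0 _).trans hj
  have hblock : ∀ s, ∏ j ∈ Finset.range L, f (s + j) ≤ r := fun s => by
    obtain ⟨j, hj, hjr⟩ := h s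
    rw [← Finset.mul_prod_erase _ _ (Finset.mem_range.2 hj)]
    exact (mul_le_of_le_one_right (hf0 _) (Finset.prod_le_one (fun i _ => hf0 _)
      fun i _ => hf1 _)).trans hjr
  have hq : ∀ q, ∏ j ∈ Finset.range (L * q), f j ≤ r ^ q := fun q => by
    induction q with
    | zero => simp
    | succ q ih =>
      rw [mul_add, mul_one, Finset.prod_range_add, pow_succ]
      exact mul_le_mul ih (hblock _) (Finset.prod_nonneg fun i _ => hf0 _) (pow_nonneg hr q)
  conv_lhs => rw [← Nat.div_add_mod n L, Finset.prod_range_add]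
  exact (mul_le_of_le_one_right (Finset.prod_nonneg fun i _ => hf0 _)
    (Finset.prod_le_one (fun i _ => hf0 _) fun i _ => hf1 _)).trans (hq _)

end Counting

/-! ### Decay of the Fourier coefficients -/

section Main

variable {k : ℕ}

/-- In every window of logarithmic length, some Fourier factor is bounded away from `1`. -/
lemma exists_small_factor (A : Matrix (Fin k) (Fin k) ℤ) (μ : PMF (Fin k → ℤ))
    (hA : ∀ z : ℂ, Module.End.HasEigenvalue (Matrix.toLin' (A.map (Int.cast : ℤ → ℂ))) z →
      z ≠ 0 ∧ ‖z‖ ≠ 1)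
    (B : Matrix (Fin k) (Fin k) ℤ) (hB : ∀ j, (fun i => B i j) ∈ orbitSet A μ) :
    ∃ δ : ℝ, 0 < δ ∧ ∃ m : ℕ, ∀ (p t : ℕ) [NeZero p], p < 2 ^ t →
      Int.gcd B.det p = 1 → ∀ α : Fin k → ZMod p, α ≠ 0 →
        ∃ j < 2 * (m * t) + minDegree A + 1,
          ‖charFunMod μ p ((dualMatrix p A ^ j).mulVec α)‖ ≤ 1 - δ := by
  choose v hv e he hBv using hB
  obtain ⟨η, hη0, hη, m, hm⟩ := exists_far_iterate A B hA (minDegree A) e he v hBv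
  choose h hh l hl hvl using hv
  choose δ hδ0 hδ using fun i => exists_gap μ (hh i) (hl i) hη0 hη
  -- A positive lower bound for finitely many gaps, valid also when `k = 0` and there are none.
  have hev : ∀ᶠ x : ℝ in 𝓝[>] 0, ∀ i, x ≤ δ i := by
    rw [eventually_all]
    exact fun i => (eventually_le_nhds (hδ0 i)).filter_mono nhdsWithin_le_nhds
  obtain ⟨x, hx, hx0⟩ := (hev.and self_mem_nhdsWithin).exists
  refine ⟨x, hx0, m, fun p t _ hpt hgcd α hα => ?_⟩
  obtain ⟨j, hj, i, hi⟩ := hm p t hpt hgcd α hα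
  refine ⟨j, hj, ?_⟩
  by_contra! hcon
  refine absurd (hδ i p _ (lt_of_le_of_lt ?_ hcon)) (not_lt.2 ?_)
  · linarith [hx i]
  · rwa [← hvl i]

lemma exists_window_length (m d : ℕ) :
    ∃ C : ℝ, 0 < C ∧ ∀ p : ℕ, 2 ≤ p → ∃ t : ℕ, p < 2 ^ t ∧
      ((2 * (m * t) + d + 1 : ℕ) : ℝ) ≤ C * Real.log p := by
  have hlog2 : 0 < Real.log 2 := Real.log_pos one_lt_two
  refine ⟨(4 * m + d + 1) / Real.log 2, by positivity, fun p hp => ?_⟩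
  have hp0 : (0 : ℝ) < p := by positivity
  refine ⟨Nat.log 2 p + 1, Nat.lt_pow_succ_log_self one_lt_two p, ?_⟩
  have h1 : Real.log 2 ≤ Real.log p := Real.log_le_log two_pos (by exact_mod_cast hp)
  have h2 : (Nat.log 2 p : ℝ) * Real.log 2 ≤ Real.log p := by
    rw [← Real.log_pow]
    refine Real.log_le_log (by positivity) ?_
    exact_mod_cast Nat.pow_log_le_self 2 (by omega)
  rw [div_mul_eq_mul_div, le_div_iff₀ hlog2]
  push_cast
  have hm : (0 : ℝ) ≤ m := m.cast_nonneg
  have hd : (0 : ℝ) ≤ d := d.cast_nonneg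
  nlinarith [mul_le_mul_of_nonneg_left h1 hm, mul_le_mul_of_nonneg_left h2 hm,
    mul_le_mul_of_nonneg_left h1 hd]

/-- Polynomially small bound for the nontrivial Fourier coefficients after `c (log p)²` steps. -/
lemma exists_fourier_decay (A : Matrix (Fin k) (Fin k) ℤ) (μ : PMF (Fin k → ℤ))
    (hA : ∀ z : ℂ, Module.End.HasEigenvalue (Matrix.toLin' (A.map (Int.cast : ℤ → ℂ))) z →
      z ≠ 0 ∧ ‖z‖ ≠ 1)
    (B : Matrix (Fin k) (Fin k) ℤ) (hB : ∀ j, (fun i => B i j) ∈ orbitSet A μ) :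
    ∃ c : ℝ, 0 < c ∧ ∃ D : ℝ, 0 < D ∧ ∀ (p : ℕ) [NeZero p],
      Int.gcd A.det p = 1 → Int.gcd B.det p = 1 → ∀ n : ℕ, c * Real.log p ^ 2 ≤ n →
        ∀ α : Fin k → ZMod p, α ≠ 0 →
          (∏ j ∈ Finset.range n, ‖charFunMod μ p ((dualMatrix p A ^ j).mulVec α)‖) ^ 2 ≤
            D / (p : ℝ) ^ (k + 1) := by
  obtain ⟨δ, hδ, m, hm⟩ := exists_small_factor A μ hA B hB
  obtain ⟨C, hC, hwin⟩ := exists_window_length m (minDegree A)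
  -- This gives at least `(k + 1) log p / (2δ) - 1` full windows, each contributing `exp (-2δ)` to
  -- the square; the factor `exp (2δ)` pays for the `- 1`.
  refine ⟨C * (k + 1) / (2 * δ), by positivity, Real.exp (2 * δ), Real.exp_pos _,
    fun p _ hgA hgB n hn α hα => ?_⟩
  have hp1 : p ≠ 1 := by
    rintro rfl
    exact hα (Subsingleton.elim _ _)
  have hp2 : 2 ≤ p := by have := NeZero.ne p; omega
  have hp0 : (0 : ℝ) < p := by positivity
  have hlog : 0 < Real.log p := Real.log_pos (by exact_mod_cast hp2)
  obtain ⟨t, hpt, hL⟩ := hwin p hp2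
  set L := 2 * (m * t) + minDegree A + 1 with hLdef
  have hL0 : 0 < L := by omega
  have hprod := prod_range_le_pow
    (f := fun j => ‖charFunMod μ p ((dualMatrix p A ^ j).mulVec α)‖)
    (fun j => norm_nonneg _) (fun j => norm_charFunMod_le_one _ _ _) (r := Real.exp (-δ)) (L := L)
    (fun s => by
      obtain ⟨j, hj, hle⟩ := hm p t hpt hgB _ (dualMatrix_pow_mulVec_ne_zero hgA hα s)
      refine ⟨j, hj, ?_⟩
      rw [Matrix.mulVec_mulVec, ← pow_add, add_comm] at hle
      linarith [Real.add_one_le_exp (-δ)]) n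
  have hq : (k + 1) / (2 * δ) * Real.log p - 1 ≤ (n / L : ℕ) := by
    have h1 : (n : ℝ) < L * ((n / L : ℕ) + 1) := by
      exact_mod_cast Nat.lt_mul_div_succ n hL0
    have h2 : (n : ℝ) ≤ (C * Real.log p) * ((n / L : ℕ) + 1) :=
      h1.le.trans (mul_le_mul_of_nonneg_right hL (by positivity))
    have h3 : (C * Real.log p) * ((k + 1) / (2 * δ) * Real.log p) ≤
        (C * Real.log p) * ((n / L : ℕ) + 1) := by
      refine le_trans (le_of_eq ?_) (hn.trans h2)
      ring
    linarith [le_of_mul_le_mul_left h3 (by positivity)]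
  refine (pow_le_pow_left₀ (Finset.prod_nonneg fun _ _ => norm_nonneg _) hprod 2).trans ?_
  have hpk : (p : ℝ) ^ (k + 1) = Real.exp ((k + 1) * Real.log p) := by
    rw [← Real.exp_log (pow_pos hp0 (k + 1)), Real.log_pow]
    push_cast
    rfl
  rw [← Real.exp_nat_mul, ← Real.exp_nat_mul, hpk, ← Real.exp_sub, Real.exp_le_exp]
  have h4 := mul_le_mul_of_nonneg_left hq (by positivity : (0 : ℝ) ≤ 2 * δ)
  have h5 : 2 * δ * ((k + 1) / (2 * δ) * Real.log p - 1) = (k + 1) * Real.log p - 2 * δ := by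
    field_simp
  rw [h5] at h4
  push_cast
  linarith

end Main

end AffineChain

end

theorem theorem3p1 {k : ℕ} (A : Matrix (Fin k) (Fin k) ℤ) (μ : PMF (Fin k → ℤ))
    (hA : ∀ z : ℂ, Module.End.HasEigenvalue (Matrix.toLin' (A.map (Int.cast : ℤ → ℂ))) z →
      z ≠ 0 ∧ ‖z‖ ≠ 1)
    (hμ : ∀ W : Submodule ℚ (Fin k → ℚ), W ≠ ⊤ → AffineChain.IsInvariant A W →
      ¬ AffineChain.IsParallelTo μ.support W) :
    (∃ B : Matrix (Fin k) (Fin k) ℤ, AffineChain.IsBasisMatrix A μ B) ∧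
    ∀ B : Matrix (Fin k) (Fin k) ℤ, AffineChain.IsBasisMatrix A μ B →
      ∃ c : ℝ, 0 < c ∧ ∃ ε : ℕ → ℝ, Tendsto ε atTop (𝓝 0) ∧
        ∀ {Ω : Type*} [MeasurableSpace Ω] (P : Measure Ω) [IsProbabilityMeasure P]
          (b : ℕ → Ω → (Fin k → ℤ)), AffineChain.IsIIDWithLaw P b μ →
        ∀ (x₀ : Fin k → ℤ) (p : ℕ) [NeZero p],
          Int.gcd A.det (p : ℤ) = 1 → Int.gcd B.det (p : ℤ) = 1 →
          ∀ n : ℕ, c * (Real.log p) ^ 2 ≤ (n : ℝ) →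
            AffineChain.tvDist (AffineChain.chainLaw P p A x₀ b n)
              (AffineChain.uniformMass (Fin k → ZMod p)) ≤ ε p := by
  refine ⟨AffineChain.exists_isBasisMatrix A μ hμ, fun B hB => ?_⟩
  obtain ⟨c, hc, D, hD, hdecay⟩ := AffineChain.exists_fourier_decay A μ hA B hB.1
  -- At most `p ^ k` frequencies, each contributing at most `D / p ^ (k + 1)`.
  refine ⟨c, hc, fun p => Real.sqrt (1 / 4 * (D / p)), ?_, ?_⟩
  · have h1 : Tendsto (fun p : ℕ => 1 / 4 * (D / (p : ℝ))) atTop (𝓝 (1 / 4 * 0)) :=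
      (tendsto_const_div_atTop_nhds_zero_nat D).const_mul _
    have h2 := (Real.continuous_sqrt.tendsto _).comp h1
    rwa [mul_zero, Real.sqrt_zero] at h2
  · intro Ω _ P _ b hb x₀ p _ hgA hgB n hn
    have hp0 : (0 : ℝ) < p := Nat.cast_pos.2 (NeZero.pos p)
    refine Real.le_sqrt_of_sq_le ((AffineChain.tvDist_uniformMass_sq_le _
      (AffineChain.sum_chainLaw hb p A x₀ n)).trans ?_)
    refine mul_le_mul_of_nonneg_left ?_ (by norm_num)
    refine (Finset.sum_le_card_nsmul _ _ (D / (p : ℝ) ^ (k + 1)) fun α hα => ?_).trans ?_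
    · rw [AffineChain.norm_fourierSum_chainLaw hb]
      exact hdecay p hgA hgB n hn α (Finset.ne_of_mem_erase hα)
    · have hcard : ((Finset.univ.erase (0 : Fin k → ZMod p)).card : ℝ) ≤ (p : ℝ) ^ k := by
        have := Finset.card_le_univ (Finset.univ.erase (0 : Fin k → ZMod p))
        rw [Fintype.card_fun, ZMod.card, Fintype.card_fin] at this
        exact_mod_cast this
      rw [nsmul_eq_mul]
      refine (mul_le_mul_of_nonneg_right hcard (by positivity)).trans (le_of_eq ?_)
      rw [pow_succ]
      field_simp
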